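/- Let $n,j,k\in\mathbb N$ with $n\ge 1$ and $1\le j<k$, and let $X,Y$ be rearrangement-invariant Banach function spaces over $\mathbb R^n$ with Lebesgue measure (in the sense of Bennett--Sharpley). For a functional $\|\cdot\|_Z$ on measurable functions and $\alpha>0$ put $\|f\|_{Z^{\alpha}}:=\big\||f|^{\alpha}\big\|_Z^{1/\alpha}$; for functionals $\|\cdot\|_W,\|\cdot\|_X$ put $\|f\|_{W^{X}}:=\sup_{\|g\|_W\le 1}\|fg\|_X$. We say that $W$ is locally embedded into $X$ if for every measurable $E\subset\mathbb R^n$ with $|E|<\infty$ there is a constant $C_E<\infty$ such that $\|f\chi_E\|_X\le C_E\|f\chi_E\|_W$ for all measurable $f$. For a scalar- or vector-valued measurable function $f$ let $f^*(t):=\inf\{s\in(0,\infty):|\{|f|>s\}|\le t\}$ (with $\inf\emptyset=\infty$) and $f^{**}(t):=\frac1t\int_0^t f^*(s)\,ds$ for $t>0$. For a function $h$ on $(0,\infty)$ and a rearrangement-invariant functional $\|\cdot\|_Z$ over $\mathbb R^n$, $\|h\|_Z$ denotes the norm of $h$ in the Luxemburg representation of $Z$ over $(0,\infty)$, that is, the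 value of $\|\cdot\|_Z$ at the function $x\mapsto h^*(|B(0,|x|)|)$ on $\mathbb R^n$, which is equimeasurable with $h$ (so that $\|f\|_Z=\|f^*\|_Z$). Assume that $Y^{k/j}$ is locally embedded into $X$. Then there is a constant $C<\infty$ such that for all $k$-times weakly differentiable functions $u:\mathbb R^n\to\mathbb R$ (that is, $u$ and its weak partial derivatives of all orders up to $k$ are locally integrable functions) $$ \|\nabla^j u\|_{X}\le C\,\|(\nabla^k u)^{**}\|_{Y}^{\frac jk}\;\|u^{**}\|_{((Y^{k/j})^{X})^{1-\frac jk}}^{1-\frac jk}, $$ except when the right-hand side is the indeterminate product $0\cdot\infty$, that is, when $\|(\nabla^k u)^{**}\|_Y=0$ and $\|u^{**}\|_{((Y^{k/j})^{X})^{1-j/k}}=\infty$. Here $\nabla^m u$ is the vector of all weak partial derivatives $\partial_{i_1}\cdots\partial_{i_m}u$, $1\le i_1,\dots,i_m\le n$, with the Euclidean norm. Norms may take the value $\infty$. -/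

import Mathlib

open MeasureTheory Set
open scoped ENNReal NNReal

noncomputable section

/-- Euclidean `n`-space. -/
abbrev RSpace (n : ℕ) : Type := EuclideanSpace ℝ (Fin n)

/-! ### Banach function norms

A function norm is a functional on the `[0, ∞]`-valued measurable functions; the norm of a scalar
or vector valued function `u` is its value at `x ↦ ‖u x‖ₑ`. -/

/-- Banach function norms (Bennett--Sharpley). "Measurable" means measurable up to a null set. -/
structure IsBanachFunctionNorm {α : Type*} [MeasurableSpace α] (μ : Measure α)
    (ρ : (α → ℝ≥0∞) → ℝ≥0∞) : Prop where
  eq_zero_iff : ∀ f, AEMeasurable f μ → (ρ f = 0 ↔ f =ᵐ[μ] 0)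
  smul : ∀ (c : ℝ≥0) (f), AEMeasurable f μ → ρ (fun x => c * f x) = c * ρ f
  add_le : ∀ f g, AEMeasurable f μ → AEMeasurable g μ → ρ (fun x => f x + g x) ≤ ρ f + ρ g
  mono : ∀ f g, AEMeasurable f μ → AEMeasurable g μ → f ≤ᵐ[μ] g → ρ f ≤ ρ g
  /-- The Fatou property. -/
  iSup_eq : ∀ F : ℕ → α → ℝ≥0∞, (∀ m, AEMeasurable (F m) μ) →
    (∀ᵐ x ∂μ, Monotone fun m => F m x) → ρ (fun x => ⨆ m, F m x) = ⨆ m, ρ (F m)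
  indicator_lt_top : ∀ E, MeasurableSet E → μ E < ∞ → ρ (E.indicator fun _ => 1) < ∞
  setLIntegral_le : ∀ E, MeasurableSet E → μ E < ∞ →
    ∃ C : ℝ≥0, ∀ f, AEMeasurable f μ → ∫⁻ x in E, f x ∂μ ≤ C * ρ f

/-- Rearrangement-invariant Banach function norms: equimeasurable functions have equal norm. -/
structure IsRIBanachFunctionNorm {α : Type*} [MeasurableSpace α] (μ : Measure α)
    (ρ : (α → ℝ≥0∞) → ℝ≥0∞) : Prop extends IsBanachFunctionNorm μ ρ where
  eq_of_equimeasurable : ∀ f g, AEMeasurable f μ → AEMeasurable g μ →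
    (∀ s : ℝ≥0∞, μ {x | s < f x} = μ {x | s < g x}) → ρ f = ρ g

/-- The norm of the `a`-convexification `X^a`: `‖u‖_{X^a} = ‖|u|^a‖_X^{1/a}`. -/
def convexification {α : Type*} (ρ : (α → ℝ≥0∞) → ℝ≥0∞) (a : ℝ) (f : α → ℝ≥0∞) : ℝ≥0∞ :=
  ρ (fun x => f x ^ a) ^ (1 / a)

/-- The norm of the space `Y^X` of Hölder multipliers:
`‖f‖_{Y^X} = sup {‖f g‖_X : ‖g‖_Y ≤ 1}`. -/
def multiplierNorm {α : Type*} [MeasurableSpace α] (μ : Measure α)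
    (ρY ρX : (α → ℝ≥0∞) → ℝ≥0∞) (f : α → ℝ≥0∞) : ℝ≥0∞ :=
  ⨆ (g : α → ℝ≥0∞) (_ : AEMeasurable g μ) (_ : ρY g ≤ 1), ρX (fun x => f x * g x)

/-- `Y` is locally embedded into `X`. -/
def LocallyEmbedded {α : Type*} [MeasurableSpace α] (μ : Measure α)
    (ρY ρX : (α → ℝ≥0∞) → ℝ≥0∞) : Prop :=
  ∀ E, MeasurableSet E → μ E < ∞ → ∃ C : ℝ≥0, ∀ f, AEMeasurable f μ →
    ρX (E.indicator f) ≤ C * ρY (E.indicator f)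

/-! ### Rearrangements -/

/-- The non-increasing rearrangement `f^*(t)`, for `t > 0`. -/
def rearrangement {α : Type*} [MeasurableSpace α] (μ : Measure α) (f : α → ℝ≥0∞) (t : ℝ) :
    ℝ≥0∞ :=
  sInf {s : ℝ≥0∞ | 0 < s ∧ s < ∞ ∧ μ {x | s < f x} ≤ ENNReal.ofReal t}

/-- The maximal function `f^{**}(t) = (1/t) ∫₀ᵗ f^*(s) ds`, for `t > 0`. -/
def maximalRearrangement {α : Type*} [MeasurableSpace α] (μ : Measure α) (f : α → ℝ≥0∞) (t : ℝ) :
    ℝ≥0∞ :=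
  (ENNReal.ofReal t)⁻¹ * ∫⁻ s in Ioo 0 t, rearrangement μ f s

/-- The radially non-increasing function `x ↦ f^*(|B(0,|x|)|)` on `ℝⁿ` that is equimeasurable with
a given function `f` on `(0, ∞)`. -/
def radialRearrangement (n : ℕ) (f : ℝ → ℝ≥0∞) (x : RSpace n) : ℝ≥0∞ :=
  rearrangement (volume.restrict (Ioi 0)) f (volume (Metric.ball (0 : RSpace n) ‖x‖)).toReal

/-- The Luxemburg representation over `(0, ∞)` of a rearrangement-invariant functional `ρ` over
`ℝⁿ`: the value at a function `f` on `(0, ∞)` is the value of `ρ` at a function on `ℝⁿ` that is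
equimeasurable with `f`. It satisfies `representation ρ u^* = ρ u`; see
`representation_rearrangement` below. -/
def representation {n : ℕ} (ρ : (RSpace n → ℝ≥0∞) → ℝ≥0∞) (f : ℝ → ℝ≥0∞) : ℝ≥0∞ :=
  ρ (radialRearrangement n f)

/-! ### Weak derivatives -/

/-- `v` is the weak gradient `∇^m u` of order `m`: the vector, normed by the Euclidean norm, of all
weak partial derivatives `∂_{i₁} ⋯ ∂_{iₘ} u`, which are locally integrable functions. -/
def IsWeakGradient {n : ℕ} (m : ℕ) (u : RSpace n → ℝ)
    (v : RSpace n → EuclideanSpace ℝ (Fin m → Fin n)) : Prop :=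
  ∀ i : Fin m → Fin n, LocallyIntegrable (fun x => v x i) ∧
    ∀ φ : RSpace n → ℝ, ContDiff ℝ (⊤ : ℕ∞) φ → HasCompactSupport φ →
      ∫ x, u x * iteratedFDeriv ℝ m φ x (fun l => EuclideanSpace.single (i l) 1)
        = (-1) ^ m * ∫ x, v x i * φ x

/-- `u` is `k`-times weakly differentiable: it is locally integrable and has locally integrable
weak partial derivatives of all orders up to `k`. -/
def WeaklyDifferentiable {n : ℕ} (k : ℕ) (u : RSpace n → ℝ) : Prop :=
  LocallyIntegrable u ∧ ∀ m ≤ k, ∃ v, IsWeakGradient m u v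


theorem lt_rearrangement_iff {α : Type*} [MeasurableSpace α] (μ : Measure α) (f : α → ℝ≥0∞)
    (s : ℝ≥0∞) (t : ℝ) :
    s < rearrangement μ f t ↔ ENNReal.ofReal t < μ {x | s < f x} := by
  rw [← not_le, ← not_le, not_iff_not]
  constructor
  · intro h
    rcases eq_or_ne s ∞ with rfl | hs
    · simp
    obtain ⟨v, hv, hvs, hvt⟩ := exists_seq_strictAnti_tendsto' (lt_top_iff_ne_top.2 hs)
    have hU : {x | s < f x} = ⋃ m, {x | v m < f x} := by
      ext x
      simp only [mem_ofPred_eq, mem_iUnion]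
      refine ⟨fun hx => ((hvt.eventually (gt_mem_nhds hx)).exists), ?_⟩
      rintro ⟨m, hm⟩
      exact (hvs m).1.trans hm
    have hmono : Monotone fun m => {x | v m < f x} := by
      intro a b hab x hx
      exact (hv.antitone hab).trans_lt hx
    rw [hU, hmono.measure_iUnion]
    refine iSup_le fun m => ?_
    obtain ⟨r, hr, hrv⟩ := sInf_lt_iff.1 (h.trans_lt (hvs m).1)
    exact (measure_mono fun x (hx : v m < f x) => hrv.trans hx).trans hr.2.2
  · intro h
    rcases eq_or_ne s ∞ with rfl | hs
    · simp
    refine le_of_forall_gt fun r hr => ?_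
    obtain ⟨q, hq1, hq2⟩ := exists_between hr
    refine lt_of_le_of_lt (sInf_le ⟨(zero_le).trans_lt hq1, hq2.trans_le le_top, ?_⟩) hq2
    exact (measure_mono fun x (hx : q < f x) => hq1.trans hx).trans h

theorem volume_ball_norm_lt {n : ℕ} (hn : 1 ≤ n) (d : ℝ≥0∞) :
    volume {x : RSpace n | volume (Metric.ball (0 : RSpace n) ‖x‖) < d} = d := by
  have : Nonempty (Fin n) := ⟨⟨0, hn⟩⟩
  have : Nontrivial (RSpace n) := inferInstance
  have hb : ∀ r : ℝ, 0 ≤ r → volume (Metric.ball (0 : RSpace n) r)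
      = ENNReal.ofReal (r ^ n) * volume (Metric.ball (0 : RSpace n) 1) := by
    intro r hr
    have := Measure.addHaar_ball (volume : Measure (RSpace n)) 0 hr
    simpa using this
  set c := volume (Metric.ball (0 : RSpace n) 1) with hc
  have hc0 : c ≠ 0 := (Metric.measure_ball_pos _ _ one_pos).ne'
  have hct : c ≠ ∞ := measure_ball_lt_top.ne
  rcases eq_or_ne d ∞ with rfl | hd
  · have : {x : RSpace n | volume (Metric.ball (0 : RSpace n) ‖x‖) < ∞} = univ := by
      ext x; simp [measure_ball_lt_top]
    rw [this]
    simp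
  set R : ℝ := ((d / c).toReal) ^ ((1 : ℝ) / n)
  have hR : 0 ≤ R := by positivity
  have hRn : R ^ n = (d / c).toReal := by
    have hn' : (n : ℝ) ≠ 0 := by positivity
    rw [← Real.rpow_natCast, ← Real.rpow_mul (by positivity)]
    simp [hn']
  have hdc : d / c ≠ ∞ := ENNReal.div_ne_top hd hc0
  have hd' : volume (Metric.ball (0 : RSpace n) R) = d := by
    rw [hb R hR, hRn, ENNReal.ofReal_toReal hdc, ENNReal.div_mul_cancel hc0 hct]
  have : {x : RSpace n | volume (Metric.ball (0 : RSpace n) ‖x‖) < d} = Metric.ball 0 R := by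
    ext x
    simp only [mem_ofPred_eq, mem_ball_zero_iff]
    rw [hb _ (norm_nonneg x), ← hd', hb R hR, ENNReal.mul_lt_mul_iff_left hc0 hct,
      ENNReal.ofReal_lt_ofReal_iff_of_nonneg (by positivity)]
    exact pow_lt_pow_iff_left₀ (norm_nonneg x) hR (by omega)
  rw [this, hd']

/-- `radialRearrangement n f` is equimeasurable with `f`. -/
theorem volume_lt_radialRearrangement {n : ℕ} (hn : 1 ≤ n) (f : ℝ → ℝ≥0∞) (s : ℝ≥0∞) :
    volume {x | s < radialRearrangement n f x} = volume.restrict (Ioi 0) {t | s < f t} := by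
  simp only [radialRearrangement, lt_rearrangement_iff,
    ENNReal.ofReal_toReal measure_ball_lt_top.ne]
  exact volume_ball_norm_lt hn _

theorem volume_lt_rearrangement {α : Type*} [MeasurableSpace α] (μ : Measure α) (f : α → ℝ≥0∞)
    (s : ℝ≥0∞) :
    volume.restrict (Ioi 0) {t | s < rearrangement μ f t} = μ {x | s < f x} := by
  simp only [lt_rearrangement_iff]
  rw [Measure.restrict_apply' measurableSet_Ioi]
  rcases eq_or_ne (μ {x | s < f x}) ∞ with h | h
  · simp [h]
  · have : {t : ℝ | ENNReal.ofReal t < μ {x | s < f x}} ∩ Ioi 0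
        = Ioo 0 (μ {x | s < f x}).toReal := by
      ext t
      simp only [mem_inter_iff, mem_ofPred_eq, mem_Ioi, mem_Ioo]
      constructor
      · rintro ⟨h1, h2⟩
        exact ⟨h2, (ENNReal.ofReal_lt_iff_lt_toReal h2.le h).1 h1⟩
      · rintro ⟨h1, h2⟩
        exact ⟨(ENNReal.ofReal_lt_iff_lt_toReal h1.le h).2 h2, h1⟩
    rw [this, Real.volume_Ioo]
    simp [ENNReal.ofReal_toReal h]

theorem measurable_radialRearrangement (n : ℕ) (f : ℝ → ℝ≥0∞) :
    Measurable (radialRearrangement n f) := by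
  have h1 : Antitone (rearrangement (volume.restrict (Ioi 0)) f) := by
    intro a b hab
    refine le_of_forall_lt fun s hs => ?_
    rw [lt_rearrangement_iff] at hs ⊢
    exact (ENNReal.ofReal_le_ofReal hab).trans_lt hs
  have h2 : Monotone fun r : ℝ => (volume (Metric.ball (0 : RSpace n) r)).toReal := by
    intro a b hab
    exact ENNReal.toReal_mono measure_ball_lt_top.ne (measure_mono (Metric.ball_subset_ball hab))
  exact (h1.measurable.comp h2.measurable).comp measurable_norm

/-- The defining property `‖u‖_X = ‖u^*‖` of the Luxemburg representation. -/
theorem representation_rearrangement {n : ℕ} (hn : 1 ≤ n) {ρ : (RSpace n → ℝ≥0∞) → ℝ≥0∞}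
    (hρ : IsRIBanachFunctionNorm volume ρ) {f : RSpace n → ℝ≥0∞} (hf : AEMeasurable f volume) :
    representation ρ (rearrangement volume f) = ρ f :=
  hρ.eq_of_equimeasurable _ _ (measurable_radialRearrangement n _).aemeasurable hf fun s => by
    rw [volume_lt_radialRearrangement hn, volume_lt_rearrangement]

end

/-! For fixed t let N_t(f) be the supremum of the integrals of |f| over sets of measure at most t.
It lies between t f^*(t) and t f^{**}(t), and it is invariant under translations. Landau's argument
therefore works in N_t exactly as in L^1: along a coordinate line, w' is a difference quotient of w
plus an error controlled by the integral of w'', so N_t(w') ≤ (2/r) N_t(w) + r N_t(w''). Optimizing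
in r makes the N_t-norms of successive derivatives log-convex up to a constant, which gives N_t(∇^j
u) ≤ C N_t(∇^k u)^{j/k} N_t(u)^{1-j/k} with C independent of t (`maxSetLIntegral_weakGradient_le`).
Optimization needs finite quantities, so it is applied to mollifications of u, all of whose
derivatives have finite N_t as soon as u does; Fatou's lemma then removes the mollifier. Dividing by
t yields the pointwise bound (∇^j u)^* ≤ C ((∇^k u)^{**})^{j/k} (u^{**})^{1-j/k}
(`rearrangement_weakGradient_le`). Taking X-norms, Hölder's inequality between Y^{k/j} and its
multipliers into X (`norm_mul_le_multiplierNorm_mul`) finishes the proof. -/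

noncomputable section

/-! ### Integrals over sets of bounded measure -/

/-- The largest integral of `f` over a set of measure at most `t`. -/
def maxSetLIntegral {α : Type*} [MeasurableSpace α] (μ : Measure α) (t : ℝ≥0∞)
    (f : α → ℝ≥0∞) : ℝ≥0∞ :=
  ⨆ (E : Set α) (_ : MeasurableSet E) (_ : μ E ≤ t), ∫⁻ x in E, f x ∂μ

section MaxSetLIntegral

variable {α : Type*} [MeasurableSpace α] {μ : Measure α} {t : ℝ≥0∞} {f g : α → ℝ≥0∞}

theorem setLIntegral_le_maxSetLIntegral {E : Set α} (hE : MeasurableSet E) (hEt : μ E ≤ t) :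
    ∫⁻ x in E, f x ∂μ ≤ maxSetLIntegral μ t f :=
  le_iSup₂_of_le E hE (le_iSup_of_le hEt le_rfl)

theorem maxSetLIntegral_le {c : ℝ≥0∞}
    (h : ∀ E, MeasurableSet E → μ E ≤ t → ∫⁻ x in E, f x ∂μ ≤ c) :
    maxSetLIntegral μ t f ≤ c :=
  iSup_le fun E => iSup₂_le (h E)

theorem maxSetLIntegral_mono (h : f ≤ g) : maxSetLIntegral μ t f ≤ maxSetLIntegral μ t g :=
  maxSetLIntegral_le fun _ hE hEt =>
    (lintegral_mono h).trans (setLIntegral_le_maxSetLIntegral hE hEt)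

end MaxSetLIntegral

/-- The layer cake formula for `[0, ∞]`-valued functions. -/
theorem lintegral_eq_lintegral_measure_lt {α : Type*} [MeasurableSpace α] (μ : Measure α)
    [SFinite μ] {f : α → ℝ≥0∞} (hf : Measurable f) :
    ∫⁻ x, f x ∂μ = ∫⁻ s in Ioi (0 : ℝ), μ {x | ENNReal.ofReal s < f x} := by
  have hm : MeasurableSet {p : α × ℝ | ENNReal.ofReal p.2 < f p.1} :=
    measurableSet_lt (by fun_prop) (by fun_prop)
  have h1 : ∀ x, f x = ∫⁻ s in Ioi (0 : ℝ),
      {p : α × ℝ | ENNReal.ofReal p.2 < f p.1}.indicator (fun _ => (1 : ℝ≥0∞)) (x, s) := by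
    intro x
    have hs : MeasurableSet {s : ℝ | ENNReal.ofReal s < f x} :=
      measurableSet_lt (by fun_prop) (by fun_prop)
    have : ∀ s : ℝ, {p : α × ℝ | ENNReal.ofReal p.2 < f p.1}.indicator
        (fun _ => (1 : ℝ≥0∞)) (x, s) = {s : ℝ | ENNReal.ofReal s < f x}.indicator 1 s := by
      intro s; simp [indicator]
    simp_rw [this]
    rw [lintegral_indicator_one hs, Measure.restrict_apply hs]
    rcases eq_or_ne (f x) ∞ with h | h
    · simp [h]
    · have : {s : ℝ | ENNReal.ofReal s < f x} ∩ Ioi 0 = Ioo 0 (f x).toReal := by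
        ext s
        simp only [mem_inter_iff, mem_ofPred_eq, mem_Ioi, mem_Ioo]
        exact ⟨fun ⟨a, b⟩ => ⟨b, (ENNReal.ofReal_lt_iff_lt_toReal b.le h).1 a⟩,
          fun ⟨a, b⟩ => ⟨(ENNReal.ofReal_lt_iff_lt_toReal a.le h).2 b, a⟩⟩
      rw [this, Real.volume_Ioo]
      simp [ENNReal.ofReal_toReal h]
  calc ∫⁻ x, f x ∂μ = ∫⁻ x, (∫⁻ s in Ioi (0 : ℝ),
      {p : α × ℝ | ENNReal.ofReal p.2 < f p.1}.indicator (fun _ => (1 : ℝ≥0∞)) (x, s)) ∂μ :=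
        lintegral_congr h1
    _ = ∫⁻ s in Ioi (0 : ℝ), (∫⁻ x,
      {p : α × ℝ | ENNReal.ofReal p.2 < f p.1}.indicator (fun _ => (1 : ℝ≥0∞)) (x, s) ∂μ) :=
        lintegral_lintegral_swap
          (f := fun x s => {p : α × ℝ | ENNReal.ofReal p.2 < f p.1}.indicator
            (fun _ => (1 : ℝ≥0∞)) (x, s)) (measurable_const.indicator hm).aemeasurable
    _ = _ := by
      refine lintegral_congr fun s => ?_
      have : ∀ x, {p : α × ℝ | ENNReal.ofReal p.2 < f p.1}.indicator
        (fun _ => (1 : ℝ≥0∞)) (x, s) = {x | ENNReal.ofReal s < f x}.indicator 1 x := by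
        intro x; simp [indicator]
      simp_rw [this]
      exact lintegral_indicator_one (measurableSet_lt measurable_const hf)

/-! ### Rearrangements and the maximal function -/

section Rearrangement

variable {α : Type*} [MeasurableSpace α] {μ : Measure α} {f : α → ℝ≥0∞}

theorem rearrangement_antitone (μ : Measure α) (f : α → ℝ≥0∞) :
    Antitone (rearrangement μ f) := by
  intro a b hab
  refine le_of_forall_lt fun s hs => ?_
  rw [lt_rearrangement_iff] at hs ⊢
  exact (ENNReal.ofReal_le_ofReal hab).trans_lt hs

theorem rearrangement_congr_ae {g : α → ℝ≥0∞} (h : f =ᵐ[μ] g) :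
    rearrangement μ f = rearrangement μ g := by
  ext t
  refine eq_of_forall_lt_iff fun s => ?_
  have : μ {x | s < f x} = μ {x | s < g x} := by
    refine measure_congr ?_
    filter_upwards [h] with x hx
    exact congrArg (s < ·) hx
  rw [lt_rearrangement_iff, lt_rearrangement_iff, this]

/-- The Hardy--Littlewood inequality for characteristic functions. -/
theorem maxSetLIntegral_le_lintegral_rearrangement [SFinite μ] (hf : AEMeasurable f μ) (t : ℝ) :
    maxSetLIntegral μ (ENNReal.ofReal t) f ≤ ∫⁻ s in Ioo 0 t, rearrangement μ f s := by
  refine maxSetLIntegral_le fun E hE hEt => ?_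
  rw [rearrangement_congr_ae hf.ae_eq_mk,
    lintegral_congr_ae (ae_restrict_of_ae hf.ae_eq_mk)]
  set g := hf.mk f
  have hg : Measurable g := hf.measurable_mk
  rw [lintegral_eq_lintegral_measure_lt _ hg,
    lintegral_eq_lintegral_measure_lt _ (rearrangement_antitone μ g).measurable]
  refine lintegral_mono fun s => ?_
  simp only [lt_rearrangement_iff]
  rw [Measure.restrict_apply' hE, Measure.restrict_apply' measurableSet_Ioo]
  -- Level by level, the superlevel set of g inside E has measure at most min(t, d), while that of
  -- the rearrangement inside (0, t) contains an interval of exactly this length.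
  set d := μ {x | ENNReal.ofReal s < g x}
  have h1 : μ ({x | ENNReal.ofReal s < g x} ∩ E) ≤ min (ENNReal.ofReal t) d :=
    le_min ((measure_mono inter_subset_right).trans hEt) (measure_mono inter_subset_left)
  refine h1.trans ?_
  have hfin : min (ENNReal.ofReal t) d ≠ ∞ := (min_le_left _ _).trans_lt (by simp) |>.ne
  have h2 : Ioo 0 (min (ENNReal.ofReal t) d).toReal ⊆
      {x : ℝ | ENNReal.ofReal x < d} ∩ Ioo 0 t := by
    rintro x ⟨hx0, hx⟩
    have h3 := (ENNReal.ofReal_lt_iff_lt_toReal hx0.le hfin).2 hx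
    refine ⟨h3.trans_le (min_le_right _ _), hx0, ?_⟩
    exact (ENNReal.ofReal_lt_ofReal_iff_of_nonneg hx0.le).1 (h3.trans_le (min_le_left _ _))
  refine le_trans ?_ (measure_mono h2)
  rw [Real.volume_Ioo, sub_zero, ENNReal.ofReal_toReal hfin]

theorem maxSetLIntegral_le_maximalRearrangement [SFinite μ] (hf : AEMeasurable f μ) {t : ℝ}
    (ht : 0 < t) :
    maxSetLIntegral μ (ENNReal.ofReal t) f
      ≤ ENNReal.ofReal t * maximalRearrangement μ f t := by
  rw [maximalRearrangement, ← mul_assoc, ENNReal.mul_inv_cancel (by simpa) (by simp), one_mul]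
  exact maxSetLIntegral_le_lintegral_rearrangement hf t

/-- Averaging over an interval independent of t makes monotonicity in t immediate. -/
theorem maximalRearrangement_eq_lintegral (μ : Measure α) (f : α → ℝ≥0∞) {t : ℝ} (ht : 0 < t) :
    maximalRearrangement μ f t = ∫⁻ s in Ioo (0 : ℝ) 1, rearrangement μ f (t * s) := by
  have hpre : (fun s : ℝ => t * s) ⁻¹' Ioo 0 t = Ioo 0 1 := by
    ext s
    simp only [mem_preimage, mem_Ioo]
    constructor
    · rintro ⟨a, b⟩
      exact ⟨pos_of_mul_pos_right a ht.le, by nlinarith⟩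
    · rintro ⟨a, b⟩
      exact ⟨by positivity, by nlinarith⟩
  have hme : MeasurableEmbedding (fun s : ℝ => t * s) :=
    (Homeomorph.mulLeft₀ t ht.ne').measurableEmbedding
  have hmap : Measure.map (fun s : ℝ => t * s) volume
      = (ENNReal.ofReal t)⁻¹ • (volume : Measure ℝ) := by
    have := Real.map_volume_mul_left ht.ne'
    rw [this, abs_of_pos (by positivity), ENNReal.ofReal_inv_of_pos ht]
  rw [← hpre, ← hme.lintegral_map (μ := volume.restrict _), ← hme.restrict_map, hmap,
    Measure.restrict_smul, lintegral_smul_measure]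
  rfl

theorem maximalRearrangement_antitoneOn (μ : Measure α) (f : α → ℝ≥0∞) {s t : ℝ} (hs : 0 < s)
    (hst : s ≤ t) : maximalRearrangement μ f t ≤ maximalRearrangement μ f s := by
  rw [maximalRearrangement_eq_lintegral μ f hs,
    maximalRearrangement_eq_lintegral μ f (hs.trans_le hst)]
  refine setLIntegral_mono' measurableSet_Ioo fun x hx => rearrangement_antitone μ f ?_
  exact mul_le_mul_of_nonneg_right hst hx.1.le

/-- Doubling pays for the strict shift s < t in `maximalRearrangement_le_rearrangement`, so that no
continuity of f^{**} is needed. -/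
theorem maximalRearrangement_le_two_mul (μ : Measure α) (f : α → ℝ≥0∞) {t : ℝ} (ht : 0 < t) :
    maximalRearrangement μ f t ≤ 2 * maximalRearrangement μ f (2 * t) := by
  unfold maximalRearrangement
  rw [ENNReal.ofReal_mul zero_le_two, ENNReal.mul_inv (by simp) (by simp), ← mul_assoc, ← mul_assoc]
  rw [ENNReal.ofReal_ofNat, ENNReal.mul_inv_cancel (by simp) (by simp), one_mul]
  gcongr
  linarith

/-- An antitone function is bounded by its own rearrangement, up to an arbitrarily small shift. -/
theorem le_rearrangement_of_antitoneOn {h : ℝ → ℝ≥0∞} (hh : AntitoneOn h (Ioi 0)) {s t : ℝ}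
    (hs : 0 ≤ s) (hst : s < t) : h t ≤ rearrangement (volume.restrict (Ioi 0)) h s := by
  refine le_of_forall_lt fun c hc => ?_
  rw [lt_rearrangement_iff]
  have : Ioc 0 t ⊆ {x | c < h x} ∩ Ioi 0 := fun x hx =>
    ⟨hc.trans_le (hh hx.1 (hs.trans_lt hst) hx.2), hx.1⟩
  rw [Measure.restrict_apply' measurableSet_Ioi]
  refine lt_of_lt_of_le ?_ (measure_mono this)
  rw [Real.volume_Ioc, sub_zero]
  exact (ENNReal.ofReal_lt_ofReal_iff (hs.trans_lt hst)).2 hst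

theorem maximalRearrangement_le_rearrangement (μ : Measure α) (f : α → ℝ≥0∞) {s t : ℝ}
    (hs : 0 ≤ s) (hst : s < t) :
    maximalRearrangement μ f t
      ≤ rearrangement (volume.restrict (Ioi 0)) (maximalRearrangement μ f) s :=
  le_rearrangement_of_antitoneOn (fun _ ha _ _ hab => maximalRearrangement_antitoneOn μ f ha hab)
    hs hst

theorem rearrangement_rearrangement (μ : Measure α) (f : α → ℝ≥0∞) :
    rearrangement (volume.restrict (Ioi 0)) (rearrangement μ f) = rearrangement μ f := by
  ext t
  refine eq_of_forall_lt_iff fun s => ?_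
  rw [lt_rearrangement_iff, lt_rearrangement_iff, volume_lt_rearrangement]

end Rearrangement

/-! ### Nonatomicity of Lebesgue measure -/

theorem measurableSet_volume_ball_norm_lt (n : ℕ) (d : ℝ≥0∞) :
    MeasurableSet {x : RSpace n | volume (Metric.ball (0 : RSpace n) ‖x‖) < d} := by
  have h2 : Monotone fun r : ℝ => volume (Metric.ball (0 : RSpace n) r) :=
    fun a b hab => measure_mono (Metric.ball_subset_ball hab)
  exact measurableSet_lt (h2.measurable.comp measurable_norm) measurable_const

/-- Subsets of Euclidean space contain sets of every smaller measure. -/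
theorem exists_subset_volume_eq {n : ℕ} (hn : 1 ≤ n) {S : Set (RSpace n)} (hS : MeasurableSet S)
    {t : ℝ} (ht : 0 ≤ t) (htS : ENNReal.ofReal t < volume S) :
    ∃ E ⊆ S, MeasurableSet E ∧ volume E = ENNReal.ofReal t := by
  -- Centred balls indexed by their measure d: the measure of S ∩ B d is 1-Lipschitz in d, so the
  -- intermediate value theorem applies.
  set B : ℝ → Set (RSpace n) := fun d =>
    {x | volume (Metric.ball (0 : RSpace n) ‖x‖) < ENNReal.ofReal d} with hB
  have hBm : ∀ d, MeasurableSet (B d) := fun d => measurableSet_volume_ball_norm_lt n _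
  have hBv : ∀ d, volume (B d) = ENNReal.ofReal d := fun d => volume_ball_norm_lt hn _
  have hBmono : Monotone B := fun a b hab x (hx : _ < _) =>
    hx.trans_le (ENNReal.ofReal_le_ofReal hab)
  have hmono : Monotone fun d => S ∩ B d := fun a b hab =>
    inter_subset_inter_right _ (hBmono hab)
  have hfin : ∀ d, volume (S ∩ B d) ≠ ∞ := fun d =>
    ((measure_mono inter_subset_right).trans_lt (by rw [hBv]; simp)).ne
  have hstep : ∀ a b, a ≤ b →
      volume (S ∩ B b) ≤ volume (S ∩ B a) + ENNReal.ofReal (b - a) := by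
    intro a b hab
    have h1 : S ∩ B b ⊆ (S ∩ B a) ∪ (B b \ B a) := by
      intro x hx
      by_cases h : x ∈ B a
      · exact Or.inl ⟨hx.1, h⟩
      · exact Or.inr ⟨hx.2, h⟩
    refine (measure_mono h1).trans ((measure_union_le _ _).trans ?_)
    gcongr
    rw [measure_sdiff (hBmono hab) (hBm a).nullMeasurableSet (by rw [hBv]; simp), hBv, hBv]
    rcases le_or_gt 0 a with ha | ha
    · rw [ENNReal.ofReal_sub _ ha]
    · rw [ENNReal.ofReal_of_nonpos ha.le, tsub_zero]
      exact ENNReal.ofReal_le_ofReal (by linarith)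
  have hlip : LipschitzWith 1 fun d => (volume (S ∩ B d)).toReal := by
    refine LipschitzWith.of_le_add_mul 1 fun a b => ?_
    rw [NNReal.coe_one, one_mul]
    rcases le_total a b with hab | hab
    · have := ENNReal.toReal_mono (hfin b) (measure_mono (hmono hab))
      exact this.trans (le_add_of_nonneg_right dist_nonneg)
    · have := ENNReal.toReal_mono (by finiteness [hfin b]) (hstep b a hab)
      rw [ENNReal.toReal_add (hfin b) (by simp), ENNReal.toReal_ofReal (by linarith)] at this
      rwa [Real.dist_eq, abs_of_nonneg (by linarith)]
  have hU : S = ⋃ m : ℕ, S ∩ B m := by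
    rw [← inter_iUnion]
    refine (inter_eq_left.2 fun x _ => ?_).symm
    obtain ⟨m, hm⟩ := ENNReal.exists_nat_gt
      (measure_ball_lt_top (μ := (volume : Measure (RSpace n))) (x := 0) (r := ‖x‖)).ne
    exact mem_iUnion.2 ⟨m, by simpa [hB] using hm⟩
  have hbig : ∃ m : ℕ, ENNReal.ofReal t < volume (S ∩ B m) := by
    have hm : Monotone fun m : ℕ => S ∩ B m := fun a b hab => hmono (Nat.cast_le.2 hab)
    rw [hU, hm.measure_iUnion] at htS
    exact lt_iSup_iff.1 htS
  obtain ⟨m, hm⟩ := hbig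
  have h0 : (volume (S ∩ B 0)).toReal = 0 := by
    rw [measure_mono_null inter_subset_right (by rw [hBv]; simp), ENNReal.toReal_zero]
  obtain ⟨d, -, hd⟩ := intermediate_value_Icc (Nat.cast_nonneg m : (0 : ℝ) ≤ m)
    hlip.continuous.continuousOn
    (show t ∈ Icc _ _ from ⟨by simpa only [h0] using ht,
      ((ENNReal.ofReal_lt_iff_lt_toReal ht (hfin _)).1 hm).le⟩)
  refine ⟨S ∩ B d, inter_subset_left, hS.inter (hBm d), ?_⟩
  rw [← hd, ENNReal.ofReal_toReal (hfin d)]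

/-- For r < f^*(t) the set {f > r} has measure above t; by nonatomicity it contains a set of measure
exactly t, over which f has integral at least r t. -/
theorem rearrangement_le_maxSetLIntegral {n : ℕ} (hn : 1 ≤ n) {f : RSpace n → ℝ≥0∞}
    (hf : AEMeasurable f) {t : ℝ} (ht : 0 < t) :
    ENNReal.ofReal t * rearrangement volume f t
      ≤ maxSetLIntegral volume (ENNReal.ofReal t) f := by
  rw [mul_comm, ← ENNReal.le_div_iff_mul_le (Or.inl (by simpa)) (Or.inl (by simp))]
  refine le_of_forall_lt fun s hs => ?_
  obtain ⟨r, hsr, hr⟩ := exists_between hs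
  refine hsr.trans_le ?_
  rw [rearrangement_congr_ae hf.ae_eq_mk, lt_rearrangement_iff] at hr
  obtain ⟨E, hES, hE, hEt⟩ := exists_subset_volume_eq hn
    (measurableSet_lt measurable_const hf.measurable_mk) ht.le hr
  rw [ENNReal.le_div_iff_mul_le (Or.inl (by simpa)) (Or.inl (by simp))]
  refine le_trans ?_ (setLIntegral_le_maxSetLIntegral hE hEt.le)
  rw [lintegral_congr_ae (ae_restrict_of_ae hf.ae_eq_mk), ← hEt, ← setLIntegral_const]
  exact setLIntegral_mono' hE fun x hx => (hES hx).le

end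

noncomputable section

open scoped Convolution ContDiff

/-! ### Interpolation of derivatives of smooth functions -/

/-- Translating E preserves its measure. This invariance carries estimates along lines and
convolution bounds over to N_t. -/
theorem maxSetLIntegral_comp_add_le {n : ℕ} (t : ℝ≥0∞) (f : RSpace n → ℝ≥0∞) (z : RSpace n)
    {E : Set (RSpace n)} (hE : MeasurableSet E) (hEt : volume E ≤ t) :
    ∫⁻ x in E, f (x + z) ≤ maxSetLIntegral volume t f := by
  have hp := measurePreserving_add_right (volume : Measure (RSpace n)) z
  have he : MeasurableEmbedding (fun x : RSpace n => x + z) :=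
    (Homeomorph.addRight z).measurableEmbedding
  rw [hp.setLIntegral_comp_emb he]
  refine setLIntegral_le_maxSetLIntegral (he.measurableSet_image.2 hE) ?_
  rwa [← hp.measure_preimage_emb he, preimage_image_eq _ he.injective]

/-- By the mean value theorem g' equals the difference quotient at some ξ in (0, r); g'(0) differs
from g'(ξ) by the integral of g'' over (0, ξ). -/
theorem enorm_deriv_zero_le {g g' g'' : ℝ → ℝ} (hg : ∀ s, HasDerivAt g (g' s) s)
    (hg' : ∀ s, HasDerivAt g' (g'' s) s) (hc : Continuous g'') {r : ℝ} (hr : 0 < r) :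
    ‖g' 0‖ₑ ≤ (ENNReal.ofReal r)⁻¹ * (‖g r‖ₑ + ‖g 0‖ₑ) + ∫⁻ s in Ioc 0 r, ‖g'' s‖ₑ := by
  obtain ⟨ξ, ⟨h0, h1⟩, hξ⟩ := exists_hasDerivAt_eq_slope g g' hr
    (fun s _ => (hg s).continuousAt.continuousWithinAt) (fun s _ => hg s)
  have hint : ∫ s in (0 : ℝ)..ξ, g'' s = g' ξ - g' 0 :=
    intervalIntegral.integral_eq_sub_of_hasDerivAt (fun s _ => hg' s) (hc.intervalIntegrable _ _)
  have heq : g' 0 = (g r - g 0) * r⁻¹ - ∫ s in Ioc 0 ξ, g'' s := by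
    rw [← intervalIntegral.integral_of_le h0.le, hint, hξ, sub_zero,
      div_eq_mul_inv]
    ring
  rw [heq]
  refine (enorm_sub_le).trans ?_
  gcongr ?_ + ?_
  · rw [enorm_mul, mul_comm, enorm_inv hr.ne', Real.enorm_of_nonneg hr.le]
    gcongr
    exact enorm_sub_le
  · refine (enorm_integral_le_lintegral_enorm _).trans ?_
    exact lintegral_mono_set (Ioc_subset_Ioc_right h1.le)

/-- Landau's inequality, in additive form, for the norms `maxSetLIntegral`. -/
theorem maxSetLIntegral_deriv_le {n : ℕ} (t : ℝ≥0∞) (e : RSpace n) {w w₁ w₂ : RSpace n → ℝ}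
    (hw : ∀ x s, HasDerivAt (fun s : ℝ => w (x + s • e)) (w₁ (x + s • e)) s)
    (hw₁ : ∀ x s, HasDerivAt (fun s : ℝ => w₁ (x + s • e)) (w₂ (x + s • e)) s)
    (hc : Continuous w) (hc₂ : Continuous w₂) {r : ℝ} (hr : 0 < r) :
    maxSetLIntegral volume t (fun x => ‖w₁ x‖ₑ)
      ≤ (ENNReal.ofReal r)⁻¹ * (2 * maxSetLIntegral volume t fun x => ‖w x‖ₑ)
        + ENNReal.ofReal r * maxSetLIntegral volume t fun x => ‖w₂ x‖ₑ := by
  refine maxSetLIntegral_le fun E hE hEt => ?_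
  have hpt : ∀ x, ‖w₁ x‖ₑ ≤ (ENNReal.ofReal r)⁻¹ * (‖w (x + r • e)‖ₑ + ‖w x‖ₑ)
      + ∫⁻ s in Ioc 0 r, ‖w₂ (x + s • e)‖ₑ := by
    intro x
    simpa using enorm_deriv_zero_le (hw x) (hw₁ x)
      (show Continuous fun s : ℝ => w₂ (x + s • e) by fun_prop) hr
  have hm : Measurable fun x => ‖w x‖ₑ := hc.enorm.measurable
  have hmr : Measurable fun x => ‖w (x + r • e)‖ₑ := hm.comp (measurable_add_const _)
  have hm₂ : Continuous fun p : RSpace n × ℝ => ‖w₂ (p.1 + p.2 • e)‖ₑ :=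
    (hc₂.comp (by fun_prop)).enorm
  refine (lintegral_mono hpt).trans ?_
  have hms : Measurable fun x => ‖w (x + r • e)‖ₑ + ‖w x‖ₑ := hmr.add hm
  rw [lintegral_add_left (hms.const_mul _), lintegral_const_mul _ hms, lintegral_add_left hmr]
  refine add_le_add (mul_le_mul_right ?_ _) ?_
  · rw [two_mul]
    exact add_le_add (maxSetLIntegral_comp_add_le t (fun x => ‖w x‖ₑ) _ hE hEt)
      (setLIntegral_le_maxSetLIntegral hE hEt)
  · rw [lintegral_lintegral_swap
      (f := fun (x : RSpace n) (s : ℝ) => ‖w₂ (x + s • e)‖ₑ) hm₂.measurable.aemeasurable]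
    refine (lintegral_mono fun s =>
      maxSetLIntegral_comp_add_le t (fun x => ‖w₂ x‖ₑ) (s • e) hE hEt).trans ?_
    simp [mul_comm]

/-- Young's inequality for convolutions in the norms `maxSetLIntegral`. -/
theorem maxSetLIntegral_convolution_le {n : ℕ} (t : ℝ≥0∞) {u ψ : RSpace n → ℝ}
    (hu : AEStronglyMeasurable u) (hψ : Continuous ψ) :
    maxSetLIntegral volume t (fun x => ‖(u ⋆[ContinuousLinearMap.mul ℝ ℝ, volume] ψ) x‖ₑ)
      ≤ (∫⁻ y, ‖ψ y‖ₑ) * maxSetLIntegral volume t fun x => ‖u x‖ₑ := by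
  refine maxSetLIntegral_le fun E hE hEt => ?_
  have hpt : ∀ x, ‖(u ⋆[ContinuousLinearMap.mul ℝ ℝ, volume] ψ) x‖ₑ
      ≤ ∫⁻ y, ‖ψ y‖ₑ * ‖u (x - y)‖ₑ := by
    intro x
    rw [convolution_mul_swap]
    refine (enorm_integral_le_lintegral_enorm _).trans (le_of_eq ?_)
    simp_rw [enorm_mul, mul_comm]
  have hm : AEMeasurable (fun p : RSpace n × RSpace n => ‖u (p.1 - p.2)‖ₑ)
      ((volume.restrict E).prod volume) := by
    have h1 : AEMeasurable (fun p : RSpace n × RSpace n => ‖u (p.1 - p.2)‖ₑ)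
        ((volume : Measure (RSpace n)).prod volume) :=
      (hu.comp_quasiMeasurePreserving (quasiMeasurePreserving_sub volume volume)).enorm
    have h2 : (volume.restrict E).prod (volume : Measure (RSpace n))
        = ((volume : Measure (RSpace n)).prod volume).restrict (E ×ˢ univ) := by
      rw [← Measure.prod_restrict, Measure.restrict_univ]
    rw [h2]
    exact h1.restrict
  refine (lintegral_mono hpt).trans ?_
  rw [lintegral_lintegral_swap (f := fun x y => ‖ψ y‖ₑ * ‖u (x - y)‖ₑ)
    (AEMeasurable.mul (by fun_prop) hm)]
  rw [← lintegral_mul_const _ (by fun_prop)]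
  refine lintegral_mono fun y => ?_
  rw [lintegral_const_mul' _ _ (by simp)]
  gcongr
  simpa only [sub_eq_add_neg] using
    maxSetLIntegral_comp_add_le t (fun x => ‖u x‖ₑ) (-y) hE hEt

/-! ### Iterated partial derivatives -/

/-- The iterated partial derivative `∂_{i₀} ⋯ ∂_{iₘ₋₁} φ`. -/
def iteratedPartial {n m : ℕ} (i : Fin m → Fin n) (φ : RSpace n → ℝ) (x : RSpace n) : ℝ :=
  iteratedFDeriv ℝ m φ x fun l => EuclideanSpace.single (i l) 1

section IteratedPartial

variable {n m : ℕ} {φ : RSpace n → ℝ}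

theorem contDiff_iteratedPartial (hφ : ContDiff ℝ ∞ φ) (i : Fin m → Fin n) :
    ContDiff ℝ ∞ (iteratedPartial i φ) := by
  have h1 : ContDiff ℝ ∞ (iteratedFDeriv ℝ m φ) :=
    hφ.iteratedFDeriv_right (by exact_mod_cast le_top)
  exact (ContinuousMultilinearMap.apply ℝ (fun _ : Fin m => RSpace n) ℝ
    (fun l => EuclideanSpace.single (i l) 1)).contDiff.comp h1

theorem hasCompactSupport_iteratedPartial (hφ : HasCompactSupport φ) (i : Fin m → Fin n) :
    HasCompactSupport (iteratedPartial i φ) :=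
  (hφ.iteratedFDeriv (𝕜 := ℝ) m).comp_left (g := fun L : ContinuousMultilinearMap ℝ
    (fun _ : Fin m => RSpace n) ℝ => L fun l => EuclideanSpace.single (i l) 1) rfl

theorem fderiv_iteratedPartial (hφ : ContDiff ℝ ∞ φ) (i : Fin m → Fin n) (l : Fin n)
    (x : RSpace n) :
    fderiv ℝ (iteratedPartial i φ) x (EuclideanSpace.single l 1)
      = iteratedPartial (Fin.cons l i) φ x := by
  have h1 : ContDiff ℝ ∞ (iteratedFDeriv ℝ m φ) :=
    hφ.iteratedFDeriv_right (by exact_mod_cast le_top)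
  have h2 : HasFDerivAt (iteratedFDeriv ℝ m φ) (fderiv ℝ (iteratedFDeriv ℝ m φ) x) x :=
    (h1.differentiable (by simp) x).hasFDerivAt
  have h3 := (ContinuousMultilinearMap.apply ℝ (fun _ : Fin m => RSpace n) ℝ
    (fun l => EuclideanSpace.single (i l) 1)).hasFDerivAt.comp x h2
  have h4 : fderiv ℝ (iteratedPartial i φ) x = _ := h3.fderiv
  rw [h4, iteratedPartial, iteratedFDeriv_succ_apply_left]
  simp [Fin.tail_def]

theorem iteratedFDeriv_comp_sub_left (hφ : ContDiff ℝ ∞ φ) (m : ℕ) (a y : RSpace n) :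
    iteratedFDeriv ℝ m (fun z => φ (a - z)) y
      = (-1 : ℝ) ^ m • iteratedFDeriv ℝ m φ (a - y) := by
  induction m generalizing y with
  | zero => ext v; simp
  | succ m ih =>
    have h1 : ContDiff ℝ ∞ (iteratedFDeriv ℝ m φ) :=
      hφ.iteratedFDeriv_right (by exact_mod_cast le_top)
    have h2 : HasFDerivAt (iteratedFDeriv ℝ m φ) (fderiv ℝ (iteratedFDeriv ℝ m φ) (a - y))
        (a - y) := (h1.differentiable (by simp) _).hasFDerivAt
    have h3 := (h2.comp y ((hasFDerivAt_id y).const_sub a)).const_smul ((-1 : ℝ) ^ m)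
    ext v
    rw [iteratedFDeriv_succ_apply_left, (h3.congr_of_eventuallyEq
      (Filter.Eventually.of_forall fun z => ih z)).fderiv]
    simp [pow_succ, iteratedFDeriv_succ_apply_left]

/-- The weak derivative is tested against y ↦ φ(x - y); the sign from this reflection cancels the
one from integration by parts. -/
theorem convolution_iteratedPartial_of_isWeakGradient {u : RSpace n → ℝ}
    {v : RSpace n → EuclideanSpace ℝ (Fin m → Fin n)} (hv : IsWeakGradient m u v)
    (hφ : ContDiff ℝ ∞ φ) (hφc : HasCompactSupport φ) (i : Fin m → Fin n) :
    u ⋆[ContinuousLinearMap.mul ℝ ℝ, volume] iteratedPartial i φ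
      = (fun x => v x i) ⋆[ContinuousLinearMap.mul ℝ ℝ, volume] φ := by
  ext x
  have h := (hv i).2 (fun y => φ (x - y)) (by fun_prop)
    (hφc.comp_homeomorph (Homeomorph.subLeft x))
  simp only [iteratedFDeriv_comp_sub_left hφ, smul_apply,
    smul_eq_mul, mul_left_comm _ ((-1 : ℝ) ^ m), integral_const_mul] at h
  exact mul_left_cancel₀ (pow_ne_zero m (by norm_num)) h

theorem continuous_convolution_iteratedPartial {u : RSpace n → ℝ} (hu : LocallyIntegrable u)
    (hφ : ContDiff ℝ ∞ φ) (hφc : HasCompactSupport φ) (i : Fin m → Fin n) :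
    Continuous (u ⋆[ContinuousLinearMap.mul ℝ ℝ, volume] iteratedPartial i φ) :=
  (hasCompactSupport_iteratedPartial hφc i).continuous_convolution_right _ hu
    (contDiff_iteratedPartial hφ i).continuous

/-- All derivatives fall on the kernel, so every order is available whatever the regularity of u. -/
theorem hasDerivAt_convolution_iteratedPartial {u : RSpace n → ℝ} (hu : LocallyIntegrable u)
    (hφ : ContDiff ℝ ∞ φ) (hφc : HasCompactSupport φ) (i : Fin m → Fin n) (l : Fin n)
    (x : RSpace n) (s : ℝ) :
    HasDerivAt (fun s : ℝ => (u ⋆[ContinuousLinearMap.mul ℝ ℝ, volume] iteratedPartial i φ)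
        (x + s • EuclideanSpace.single l 1))
      ((u ⋆[ContinuousLinearMap.mul ℝ ℝ, volume] iteratedPartial (Fin.cons l i) φ)
        (x + s • EuclideanSpace.single l 1)) s := by
  have hc := hasCompactSupport_iteratedPartial hφc i
  have hd : ContDiff ℝ 1 (iteratedPartial i φ) :=
    (contDiff_iteratedPartial hφ i).of_le (by exact_mod_cast le_top)
  have h1 := hc.hasFDerivAt_convolution_right (ContinuousLinearMap.mul ℝ ℝ) hu hd
    (x + s • EuclideanSpace.single l 1)
  have h2 : HasDerivAt (fun s : ℝ => x + s • (EuclideanSpace.single l 1 : RSpace n))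
      (EuclideanSpace.single l 1) s := by
    simpa using ((hasDerivAt_id s).smul_const (EuclideanSpace.single l 1 : RSpace n)).const_add x
  have h3 := h1.comp_hasDerivAt s h2
  rw [convolution_precompR_apply _ hu (hc.fderiv ℝ) (hd.continuous_fderiv one_ne_zero)] at h3
  simp_rw [fderiv_iteratedPartial hφ] at h3
  exact h3

end IteratedPartial

end

noncomputable section

open scoped Convolution ContDiff

/-! ### Logarithmically convex sequences -/

theorem pow_succ_le_of_sq_le_mul {b : ℕ → ℝ} (hb : ∀ m, 0 ≤ b m)
    (h : ∀ m, b (m + 1) ^ 2 ≤ b m * b (m + 2)) (m : ℕ) :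
    b m ^ (m + 1) ≤ b 0 * b (m + 1) ^ m := by
  induction m with
  | zero => simp
  | succ m ih =>
    rcases (hb (m + 1)).eq_or_lt with h0 | h0
    · rw [← h0, zero_pow (by omega)]
      exact mul_nonneg (hb _) (pow_nonneg (hb _) _)
    · refine le_of_mul_le_mul_right ?_ (pow_pos h0 m)
      calc b (m + 1) ^ (m + 1 + 1) * b (m + 1) ^ m = (b (m + 1) ^ 2) ^ (m + 1) := by ring
        _ ≤ (b m * b (m + 2)) ^ (m + 1) := by gcongr; exact h m
        _ = b m ^ (m + 1) * b (m + 2) ^ (m + 1) := by ring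
        _ ≤ b 0 * b (m + 1) ^ m * b (m + 2) ^ (m + 1) :=
          mul_le_mul_of_nonneg_right ih (pow_nonneg (hb _) _)
        _ = b 0 * b (m + 1 + 1) ^ (m + 1) * b (m + 1) ^ m := by ring_nf

/-- Log-convexity in root-free form. Raising to the power j + d lets `pow_succ_le_of_sq_le_mul`
replace the endpoint b (j + d) by b (j + d + 1). -/
theorem pow_add_le_of_sq_le_mul {b : ℕ → ℝ} (hb : ∀ m, 0 ≤ b m)
    (h : ∀ m, b (m + 1) ^ 2 ≤ b m * b (m + 2)) (j d : ℕ) :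
    b j ^ (j + d) ≤ b 0 ^ d * b (j + d) ^ j := by
  induction d with
  | zero => simp
  | succ d ih =>
    rcases Nat.eq_zero_or_pos (j + d) with h0 | h0
    · obtain ⟨rfl, rfl⟩ : j = 0 ∧ d = 0 := by omega
      simp
    · have hR : 0 ≤ b 0 ^ (d + 1) * b (j + (d + 1)) ^ j :=
        mul_nonneg (pow_nonneg (hb _) _) (pow_nonneg (hb _) _)
      refine (pow_le_pow_iff_left₀ (pow_nonneg (hb _) _) hR h0.ne').1 ?_
      calc (b j ^ (j + (d + 1))) ^ (j + d) = (b j ^ (j + d)) ^ (j + d + 1) := by ring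
        _ ≤ (b 0 ^ d * b (j + d) ^ j) ^ (j + d + 1) :=
          pow_le_pow_left₀ (pow_nonneg (hb _) _) ih _
        _ = b 0 ^ (d * (j + d + 1)) * (b (j + d) ^ (j + d + 1)) ^ j := by ring
        _ ≤ b 0 ^ (d * (j + d + 1)) * (b 0 * b (j + d + 1) ^ (j + d)) ^ j :=
          mul_le_mul_of_nonneg_left (pow_le_pow_left₀ (pow_nonneg (hb _) _)
            (pow_succ_le_of_sq_le_mul hb h _) _) (pow_nonneg (hb _) _)
        _ = (b 0 ^ (d + 1) * b (j + (d + 1)) ^ j) ^ (j + d) := by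
          rw [← add_assoc]; ring

/-- Landau's inequalities between consecutive terms imply the interpolation inequality between
the first and the last one. -/
theorem interpolation_of_le_inv_mul_add_mul {a : ℕ → ℝ≥0∞} (ha : ∀ m, a m ≠ ⊤)
    (h : ∀ m (r : ℝ), 0 < r →
      a (m + 1) ≤ (ENNReal.ofReal r)⁻¹ * (2 * a m) + ENNReal.ofReal r * a (m + 2))
    {j k : ℕ} (hk : 0 < k) (hjk : j ≤ k) :
    a j ≤ 3 ^ (k * j) * (a k ^ ((j : ℝ) / k) * a 0 ^ (1 - (j : ℝ) / k)) := by
  lift a to ℕ → ℝ≥0 using ha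
  have hsq : ∀ m, (a (m + 1) : ℝ) ^ 2 ≤ 9 * (a m * a (m + 2)) := by
    intro m
    -- The hypothesis multiplied by r; for r ≤ 0 every term is nonnegative. The discriminant then
    -- gives the constant 8, relaxed to 9 = 3^2.
    have hr : ∀ r : ℝ, 0 ≤ a (m + 2) * (r * r) + (-a (m + 1)) * r + 2 * a m := by
      intro r
      rcases le_or_gt r 0 with hr | hr
      · have h1 : 0 ≤ (a (m + 1) : ℝ) * (-r) := mul_nonneg (NNReal.coe_nonneg _) (by linarith)
        have h2 : 0 ≤ (a (m + 2) : ℝ) * (r * r) :=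
          mul_nonneg (NNReal.coe_nonneg _) (mul_self_nonneg r)
        have h3 : 0 ≤ (a m : ℝ) := NNReal.coe_nonneg _
        linarith
      · have h1 := ENNReal.toReal_mono (by finiteness [hr]) (h m r hr)
        rw [ENNReal.toReal_add (by finiteness) (by finiteness)] at h1
        simp only [ENNReal.toReal_mul, ENNReal.toReal_inv, ENNReal.toReal_ofReal hr.le,
          ENNReal.coe_toReal, ENNReal.toReal_ofNat] at h1
        have h2 := mul_le_mul_of_nonneg_left h1 hr.le
        rw [mul_add, ← mul_assoc, mul_inv_cancel₀ hr.ne'] at h2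
        linarith
    have := discrim_le_zero hr
    have h3 : 0 ≤ (a m : ℝ) * a (m + 2) := by positivity
    rw [discrim] at this
    linarith
  -- The weight 3^(m^2) absorbs the factor 9, since m^2 + (m+2)^2 = 2(m+1)^2 + 2.
  have hb := pow_add_le_of_sq_le_mul (b := fun m => 3 ^ (m ^ 2) * (a m : ℝ))
    (fun m => by positivity) (fun m => by
      calc (3 ^ ((m + 1) ^ 2) * (a (m + 1) : ℝ)) ^ 2
          = 3 ^ (2 * (m + 1) ^ 2) * (a (m + 1) : ℝ) ^ 2 := by ring
        _ ≤ 3 ^ (2 * (m + 1) ^ 2) * (9 * ((a m : ℝ) * a (m + 2))) := by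
          gcongr; exact hsq m
        _ = 3 ^ (m ^ 2) * (a m : ℝ) * (3 ^ ((m + 2) ^ 2) * (a (m + 2) : ℝ)) := by ring) j (k - j)
  simp only [Nat.add_sub_cancel' hjk] at hb
  have hc : a j ^ k ≤ (3 ^ (k * j)) ^ k * (a k ^ j * a 0 ^ (k - j)) := by
    have h1 : (a j : ℝ) ^ k ≤ (3 ^ (j ^ 2) * (a j : ℝ)) ^ k := by
      gcongr
      exact le_mul_of_one_le_left (NNReal.coe_nonneg _) (one_le_pow₀ (by norm_num))
    have h2 := h1.trans hb
    rw [← NNReal.coe_le_coe]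
    push_cast
    refine h2.trans (le_of_eq ?_)
    simp only [mul_pow]
    ring
  have hk0 : (k : ℝ) ≠ 0 := by positivity
  have hd : ((k - j : ℕ) : ℝ) = k - j := by rw [Nat.cast_sub hjk]
  have hroot := NNReal.rpow_le_rpow hc (show (0 : ℝ) ≤ (k : ℝ)⁻¹ by positivity)
  rw [NNReal.mul_rpow, NNReal.mul_rpow, NNReal.pow_rpow_inv_natCast _ hk.ne',
    NNReal.pow_rpow_inv_natCast _ hk.ne', ← NNReal.rpow_natCast (a k), ← NNReal.rpow_mul,
    ← NNReal.rpow_natCast (a 0), ← NNReal.rpow_mul, hd, ← div_eq_mul_inv, ← div_eq_mul_inv,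
    sub_div, div_self hk0] at hroot
  have hjk' : (0 : ℝ) ≤ 1 - (j : ℝ) / k := by
    rw [sub_nonneg]; exact div_le_one_of_le₀ (by exact_mod_cast hjk) (by positivity)
  rw [← ENNReal.coe_rpow_of_nonneg _ (by positivity), ← ENNReal.coe_rpow_of_nonneg _ hjk']
  refine (ENNReal.coe_le_coe.2 hroot).trans (le_of_eq ?_)
  push_cast
  rfl

/-! ### The interpolation inequality for weak derivatives -/

theorem EuclideanSpace.enorm_le_sum {ι : Type*} [Fintype ι] (v : EuclideanSpace ℝ ι) :
    ‖v‖ₑ ≤ ∑ i, ‖v i‖ₑ := by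
  have h : ‖v‖ ≤ ∑ i, ‖v i‖ := by
    rw [EuclideanSpace.norm_eq]
    refine Real.sqrt_le_iff.2 ⟨Finset.sum_nonneg fun _ _ => norm_nonneg _, ?_⟩
    exact Finset.sum_sq_le_sq_sum_of_nonneg fun _ _ => norm_nonneg _
  calc ‖v‖ₑ = ENNReal.ofReal ‖v‖ := (ofReal_norm v).symm
    _ ≤ ENNReal.ofReal (∑ i, ‖v i‖) := ENNReal.ofReal_le_ofReal h
    _ = ∑ i, ‖v i‖ₑ := by
      rw [ENNReal.ofReal_sum_of_nonneg fun _ _ => norm_nonneg _]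
      simp only [ofReal_norm]

theorem EuclideanSpace.enorm_apply_le {ι : Type*} [Fintype ι] (v : EuclideanSpace ℝ ι) (i : ι) :
    ‖v i‖ₑ ≤ ‖v‖ₑ := by
  rw [← ofReal_norm, ← ofReal_norm]
  exact ENNReal.ofReal_le_ofReal (PiLp.norm_apply_le v i)

theorem IsWeakGradient.aemeasurable_enorm {n m : ℕ} {u : RSpace n → ℝ}
    {v : RSpace n → EuclideanSpace ℝ (Fin m → Fin n)} (hv : IsWeakGradient m u v) :
    AEMeasurable fun x => ‖v x‖ₑ := by
  have h1 : AEMeasurable fun x => (fun i => v x i) :=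
    aemeasurable_pi_lambda _ fun i => (hv i).1.aestronglyMeasurable.aemeasurable
  have h2 : AEMeasurable v := (WithLp.measurable_toLp 2 _).comp_aemeasurable h1
  exact h2.enorm

theorem maxSetLIntegral_convolution_iteratedPartial_le {n : ℕ} {u : RSpace n → ℝ}
    (hu : LocallyIntegrable u) {j k : ℕ} (hk : 0 < k) (hjk : j ≤ k)
    {v : RSpace n → EuclideanSpace ℝ (Fin k → Fin n)} (hv : IsWeakGradient k u v)
    {φ : RSpace n → ℝ} (hφ : ContDiff ℝ ∞ φ) (hφc : HasCompactSupport φ)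
    (hφ1 : ∫⁻ y, ‖φ y‖ₑ ≤ 1) {t : ℝ≥0∞}
    (hfin : maxSetLIntegral volume t (fun x => ‖u x‖ₑ) ≠ ⊤) (i : Fin j → Fin n) :
    maxSetLIntegral volume t
        (fun x => ‖(u ⋆[ContinuousLinearMap.mul ℝ ℝ, volume] iteratedPartial i φ) x‖ₑ)
      ≤ 3 ^ (k * j) * (maxSetLIntegral volume t (fun x => ‖v x‖ₑ) ^ ((j : ℝ) / k)
        * maxSetLIntegral volume t (fun x => ‖u x‖ₑ) ^ (1 - (j : ℝ) / k)) := by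
  -- With the supremum over all multi-indices, Landau's inequality in direction l, which involves
  -- ∂_i, ∂_l ∂_i and ∂_l ∂_l ∂_i, becomes a relation between consecutive terms.
  set a : ℕ → ℝ≥0∞ := fun m => ⨆ i : Fin m → Fin n, maxSetLIntegral volume t
    (fun x => ‖(u ⋆[ContinuousLinearMap.mul ℝ ℝ, volume] iteratedPartial i φ) x‖ₑ) with ha
  have hle : ∀ m (i : Fin m → Fin n), maxSetLIntegral volume t
    (fun x => ‖(u ⋆[ContinuousLinearMap.mul ℝ ℝ, volume] iteratedPartial i φ) x‖ₑ) ≤ a m :=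
    fun m i => le_iSup (fun i : Fin m → Fin n => maxSetLIntegral volume t
      (fun x => ‖(u ⋆[ContinuousLinearMap.mul ℝ ℝ, volume] iteratedPartial i φ) x‖ₑ)) i
  -- Finiteness by Young's inequality; the bound depends on φ but does not enter the final constant.
  have haf : ∀ m, a m ≠ ⊤ := by
    intro m
    refine ne_of_lt ?_
    simp only [ha]
    rw [← Finset.sup_univ_eq_iSup, Finset.sup_lt_iff (by simp)]
    intro i _
    have hc := (contDiff_iteratedPartial hφ i).continuous
    have hint := hc.integrable_of_hasCompactSupport (μ := volume)
      (hasCompactSupport_iteratedPartial hφc i)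
    exact (maxSetLIntegral_convolution_le t hu.aestronglyMeasurable hc).trans_lt
      (ENNReal.mul_lt_top hint.2 hfin.lt_top)
  have hstep : ∀ m (r : ℝ), 0 < r →
      a (m + 1) ≤ (ENNReal.ofReal r)⁻¹ * (2 * a m) + ENNReal.ofReal r * a (m + 2) := by
    intro m r hr
    refine iSup_le fun i => ?_
    obtain ⟨l, i, rfl⟩ : ∃ l i', i = Fin.cons l i' := ⟨i 0, Fin.tail i, by simp⟩
    refine (maxSetLIntegral_deriv_le t (EuclideanSpace.single l 1)
      (hasDerivAt_convolution_iteratedPartial hu hφ hφc i l)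
      (hasDerivAt_convolution_iteratedPartial hu hφ hφc (Fin.cons l i) l)
      (continuous_convolution_iteratedPartial hu hφ hφc _)
      (continuous_convolution_iteratedPartial hu hφ hφc _) hr).trans ?_
    gcongr
    · exact hle _ _
    · exact hle _ _
  have hmul : ∀ g : RSpace n → ℝ, AEStronglyMeasurable g →
      maxSetLIntegral volume t (fun x => ‖(g ⋆[ContinuousLinearMap.mul ℝ ℝ, volume] φ) x‖ₑ)
        ≤ maxSetLIntegral volume t (fun x => ‖g x‖ₑ) := fun g hg =>
    (maxSetLIntegral_convolution_le t hg hφ.continuous).trans (mul_le_of_le_one_left' hφ1)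
  have h0 : a 0 ≤ maxSetLIntegral volume t (fun x => ‖u x‖ₑ) := by
    refine iSup_le fun i => ?_
    have : iteratedPartial i φ = φ := by ext x; simp [iteratedPartial]
    rw [this]
    exact hmul u hu.aestronglyMeasurable
  have hak : a k ≤ maxSetLIntegral volume t (fun x => ‖v x‖ₑ) := by
    refine iSup_le fun i => ?_
    rw [convolution_iteratedPartial_of_isWeakGradient hv hφ hφc i]
    exact (hmul _ (hv i).1.aestronglyMeasurable).trans
      (maxSetLIntegral_mono fun x => EuclideanSpace.enorm_apply_le _ _)
  have hjk' : (0 : ℝ) ≤ 1 - (j : ℝ) / k := by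
    rw [sub_nonneg]; exact div_le_one_of_le₀ (by exact_mod_cast hjk) (by positivity)
  refine (hle j i).trans ((interpolation_of_le_inv_mul_add_mul haf hstep hk hjk).trans ?_)
  gcongr

/-- The Gagliardo--Nirenberg inequality for the norms `maxSetLIntegral`. -/
theorem maxSetLIntegral_weakGradient_le {n : ℕ} {u : RSpace n → ℝ}
    (hu : LocallyIntegrable u) {j k : ℕ} (hk : 0 < k) (hjk : j ≤ k)
    {w : RSpace n → EuclideanSpace ℝ (Fin j → Fin n)} (hw : IsWeakGradient j u w)
    {v : RSpace n → EuclideanSpace ℝ (Fin k → Fin n)} (hv : IsWeakGradient k u v)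
    {t : ℝ≥0∞} (hfin : maxSetLIntegral volume t (fun x => ‖u x‖ₑ) ≠ ⊤) :
    maxSetLIntegral volume t (fun x => ‖w x‖ₑ)
      ≤ (n ^ j * 3 ^ (k * j) : ℕ) * (maxSetLIntegral volume t (fun x => ‖v x‖ₑ) ^ ((j : ℝ) / k)
        * maxSetLIntegral volume t (fun x => ‖u x‖ₑ) ^ (1 - (j : ℝ) / k)) := by
  set c := maxSetLIntegral volume t (fun x => ‖v x‖ₑ) ^ ((j : ℝ) / k)
        * maxSetLIntegral volume t (fun x => ‖u x‖ₑ) ^ (1 - (j : ℝ) / k)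
  -- A bounded ratio of outer to inner radius ensures almost everywhere convergence of the
  -- mollifications.
  let Φ : ℕ → ContDiffBump (0 : RSpace n) := fun m =>
    ⟨1 / (m + 1), 2 * (1 / (m + 1)), by positivity, by
      have : (0 : ℝ) < 1 / ((m : ℝ) + 1) := by positivity
      linarith⟩
  have hΦ : Filter.Tendsto (fun m => (Φ m).rOut) Filter.atTop (nhds 0) := by
    have := (tendsto_one_div_add_atTop_nhds_zero_nat (𝕜 := ℝ)).const_mul 2
    rwa [mul_zero] at this
  have hcomp : ∀ i E, MeasurableSet E → volume E ≤ t → ∫⁻ x in E, ‖w x i‖ₑ ≤ 3 ^ (k * j) * c := by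
    intro i E hE hEt
    have hlim := ContDiffBump.ae_convolution_tendsto_right_of_locallyIntegrable (μ := volume)
      hΦ (Filter.Eventually.of_forall fun m => le_refl (2 * (Φ m).rIn)) (hw i).1
    have hconv : ∀ m, (Φ m).normed volume ⋆[ContinuousLinearMap.lsmul ℝ ℝ, volume]
        (fun x => w x i)
        = u ⋆[ContinuousLinearMap.mul ℝ ℝ, volume] iteratedPartial i ((Φ m).normed volume) := by
      intro m
      rw [convolution_iteratedPartial_of_isWeakGradient hw (Φ m).contDiff_normed
        (Φ m).hasCompactSupport_normed]
      ext x
      rw [convolution_lsmul_swap, convolution_def]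
      simp [mul_comm]
    simp only [hconv] at hlim
    have hnorm : ∀ m, ∫⁻ y, ‖(Φ m).normed volume y‖ₑ ≤ 1 := by
      intro m
      rw [← ofReal_integral_norm_eq_lintegral_enorm (Φ m).integrable_normed]
      simp only [Real.norm_of_nonneg ((Φ m).nonneg_normed _), (Φ m).integral_normed]
      simp
    calc ∫⁻ x in E, ‖w x i‖ₑ
        = ∫⁻ x in E, Filter.liminf (fun m => ‖(u ⋆[ContinuousLinearMap.mul ℝ ℝ, volume]
            iteratedPartial i ((Φ m).normed volume)) x‖ₑ) Filter.atTop := by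
          refine lintegral_congr_ae (ae_restrict_of_ae ?_)
          filter_upwards [hlim] with x hx
          exact hx.enorm.liminf_eq.symm
      _ ≤ Filter.liminf (fun m => ∫⁻ x in E, ‖(u ⋆[ContinuousLinearMap.mul ℝ ℝ, volume]
            iteratedPartial i ((Φ m).normed volume)) x‖ₑ) Filter.atTop :=
          lintegral_liminf_le fun m => (continuous_convolution_iteratedPartial hu
            (Φ m).contDiff_normed (Φ m).hasCompactSupport_normed i).enorm.measurable
      _ ≤ Filter.liminf (fun _ : ℕ => 3 ^ (k * j) * c) Filter.atTop := by
          refine Filter.liminf_le_liminf (Filter.Eventually.of_forall fun m => ?_)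
          exact (setLIntegral_le_maxSetLIntegral hE hEt).trans
            (maxSetLIntegral_convolution_iteratedPartial_le hu hk hjk hv
              (Φ m).contDiff_normed (Φ m).hasCompactSupport_normed (hnorm m) hfin i)
      _ = 3 ^ (k * j) * c := by simp
  refine maxSetLIntegral_le fun E hE hEt => ?_
  -- Summing over the n^j components produces the factor n^j.
  calc ∫⁻ x in E, ‖w x‖ₑ ≤ ∫⁻ x in E, ∑ i, ‖w x i‖ₑ :=
        lintegral_mono fun x => EuclideanSpace.enorm_le_sum _
    _ = ∑ i, ∫⁻ x in E, ‖w x i‖ₑ :=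
        lintegral_finsetSum' _ fun i _ => ((hw i).1.aestronglyMeasurable.enorm).restrict
    _ ≤ ∑ _i : Fin j → Fin n, 3 ^ (k * j) * c := Finset.sum_le_sum fun i _ => hcomp i E hE hEt
    _ = _ := by simp [mul_assoc]

end

noncomputable section

/-! ### Banach function norms and multipliers -/

section Multiplier

variable {α : Type*} [MeasurableSpace α] {μ : Measure α} {ρ ρX ρY : (α → ℝ≥0∞) → ℝ≥0∞}

theorem IsBanachFunctionNorm.eq_zero_of_ae (hρ : IsBanachFunctionNorm μ ρ) {f : α → ℝ≥0∞}
    (hf : f =ᵐ[μ] 0) : ρ f = 0 :=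
  (hρ.eq_zero_iff f (aemeasurable_zero.congr hf.symm)).2 hf

theorem IsBanachFunctionNorm.ae_lt_top [SigmaFinite μ] (hρ : IsBanachFunctionNorm μ ρ)
    {f : α → ℝ≥0∞} (hf : AEMeasurable f μ) (h : ρ f ≠ ∞) : ∀ᵐ x ∂μ, f x < ∞ := by
  refine ae_of_forall_measure_lt_top_ae_restrict _ fun E hE hEfin => ?_
  obtain ⟨C, hC⟩ := hρ.setLIntegral_le E hE hEfin
  exact ae_lt_top' hf.restrict
    ((hC f hf).trans_lt (ENNReal.mul_lt_top ENNReal.coe_lt_top h.lt_top)).ne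

theorem convexification_const_mul (hρ : IsBanachFunctionNorm μ ρ) {b : ℝ} (hb : 0 < b)
    (c : ℝ≥0) {g : α → ℝ≥0∞} (hg : AEMeasurable g μ) :
    convexification ρ b (fun x => c * g x) = c * convexification ρ b g := by
  unfold convexification
  simp only [ENNReal.mul_rpow_of_nonneg _ _ hb.le]
  rw [← ENNReal.coe_rpow_of_nonneg _ hb.le, hρ.smul _ _ (hg.pow_const b),
    ENNReal.mul_rpow_of_nonneg _ _ (by positivity), ENNReal.coe_rpow_of_nonneg _ hb.le,
    ← ENNReal.rpow_mul, mul_one_div_cancel hb.ne', ENNReal.rpow_one]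

theorem le_multiplierNorm {f g : α → ℝ≥0∞} (hg : AEMeasurable g μ) (hg1 : ρY g ≤ 1) :
    ρX (fun x => f x * g x) ≤ multiplierNorm μ ρY ρX f :=
  le_iSup₂_of_le g hg (le_iSup_of_le hg1 le_rfl)

/-- Hölder's inequality for multipliers. -/
theorem norm_mul_le_multiplierNorm_mul (hX : IsBanachFunctionNorm μ ρX)
    (hY : IsBanachFunctionNorm μ ρY) {b : ℝ} (hb : 0 < b) {f g : α → ℝ≥0∞}
    (hf : AEMeasurable f μ) (hg : AEMeasurable g μ) (hfin : convexification ρY b g ≠ ∞) :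
    ρX (fun x => f x * g x)
      ≤ multiplierNorm μ (convexification ρY b) ρX f * convexification ρY b g := by
  obtain ⟨c, hc⟩ : ∃ c : ℝ≥0, (c : ℝ≥0∞) = convexification ρY b g :=
    ⟨_, ENNReal.coe_toNNReal hfin⟩
  rcases eq_or_ne c 0 with h0 | h0
  · have h1 : ρY (fun x => g x ^ b) = 0 := by
      rw [h0, ENNReal.coe_zero, convexification] at hc
      exact (ENNReal.rpow_eq_zero_iff_of_pos (by positivity)).1 hc.symm
    have h2 := (hY.eq_zero_iff _ (hg.pow_const b)).1 h1
    rw [hX.eq_zero_of_ae]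
    · exact zero_le
    · filter_upwards [h2] with x hx
      have : g x = 0 := (ENNReal.rpow_eq_zero_iff_of_pos hb).1 hx
      simp [this]
  · have h1 : convexification ρY b (fun x => (c⁻¹ : ℝ≥0) * g x) ≤ 1 := by
      rw [convexification_const_mul hY hb _ hg, ← hc, ← ENNReal.coe_mul, inv_mul_cancel₀ h0]
      simp
    have h2 := le_multiplierNorm (ρX := ρX) (f := f) (hg.const_mul _) h1
    simp only [mul_left_comm (f _)] at h2
    rw [hX.smul _ (fun x => f x * g x) (hf.mul hg)] at h2
    calc ρX (fun x => f x * g x)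
        = c * ((c⁻¹ : ℝ≥0) * ρX (fun x => f x * g x)) := by
          rw [← mul_assoc, ← ENNReal.coe_mul, mul_inv_cancel₀ h0]; simp
      _ ≤ c * multiplierNorm μ (convexification ρY b) ρX f := by gcongr
      _ = _ := by rw [hc, mul_comm]

/-- Multipliers act on small multiples of characteristic functions. -/
theorem exists_norm_indicator_const_mul_le (hY : IsBanachFunctionNorm μ ρY) {b : ℝ} (hb : 0 < b)
    (ρX : (α → ℝ≥0∞) → ℝ≥0∞) {E : Set α} (hE : MeasurableSet E) (hEfin : μ E < ∞) :
    ∃ c : ℝ≥0, c ≠ 0 ∧ ∀ f : α → ℝ≥0∞, ρX (E.indicator fun x => f x * c)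
      ≤ multiplierNorm μ (convexification ρY b) ρX f := by
  have hm : AEMeasurable (E.indicator fun _ => (1 : ℝ≥0∞)) μ :=
    (measurable_const.indicator hE).aemeasurable
  have hq : convexification ρY b (E.indicator fun _ => 1) ≠ ∞ := by
    have : (fun x => E.indicator (fun _ => (1 : ℝ≥0∞)) x ^ b) = E.indicator fun _ => 1 := by
      ext x
      by_cases hx : x ∈ E <;> simp [hx, hb]
    rw [convexification, this]
    exact ENNReal.rpow_ne_top_of_nonneg (by positivity) (hY.indicator_lt_top E hE hEfin).ne
  obtain ⟨q, hq⟩ : ∃ q : ℝ≥0, (q : ℝ≥0∞) = convexification ρY b (E.indicator fun _ => 1) :=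
    ⟨_, ENNReal.coe_toNNReal hq⟩
  -- Here q + 1 replaces q because q = 0 when E is null.
  refine ⟨(q + 1)⁻¹, by positivity, fun f => ?_⟩
  have h1 : convexification ρY b (fun x => ((q + 1)⁻¹ : ℝ≥0) * E.indicator (fun _ => 1) x) ≤ 1 := by
    rw [convexification_const_mul hY hb _ hm, ← hq, ← ENNReal.coe_mul]
    refine ENNReal.coe_le_one_iff.2 ?_
    rw [inv_mul_le_iff₀ (by positivity)]
    simp
  refine le_trans (le_of_eq ?_) (le_multiplierNorm (hm.const_mul _) h1)
  congr 1
  ext x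
  by_cases hx : x ∈ E <;> simp [hx]

/-- Testing with small multiples of characteristic functions reduces the claim to ρX on each set of
finite measure. -/
theorem ae_lt_top_of_multiplierNorm_ne_top [SigmaFinite μ] (hX : IsBanachFunctionNorm μ ρX)
    (hY : IsBanachFunctionNorm μ ρY) {b : ℝ} (hb : 0 < b) {f : α → ℝ≥0∞} (hf : AEMeasurable f μ)
    (h : multiplierNorm μ (convexification ρY b) ρX f ≠ ∞) : ∀ᵐ x ∂μ, f x < ∞ := by
  refine ae_of_forall_measure_lt_top_ae_restrict _ fun E hE hEfin => ?_
  obtain ⟨c, hc, hcf⟩ := exists_norm_indicator_const_mul_le hY hb ρX hE hEfin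
  have h1 := hX.ae_lt_top ((hf.mul_const _).indicator hE) ((hcf f).trans_lt h.lt_top).ne
  rw [ae_restrict_iff' hE]
  filter_upwards [h1] with x hx hxE
  rw [indicator_of_mem hxE] at hx
  by_contra htop
  rw [not_lt, top_le_iff] at htop
  rw [htop, ENNReal.top_mul (by simpa using hc)] at hx
  exact lt_irrefl _ hx

theorem ae_eq_zero_of_multiplierNorm_eq_zero [SigmaFinite μ] (hX : IsBanachFunctionNorm μ ρX)
    (hY : IsBanachFunctionNorm μ ρY) {b : ℝ} (hb : 0 < b) {f : α → ℝ≥0∞} (hf : AEMeasurable f μ)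
    (h : multiplierNorm μ (convexification ρY b) ρX f = 0) : ∀ᵐ x ∂μ, f x = 0 := by
  refine ae_of_forall_measure_lt_top_ae_restrict _ fun E hE hEfin => ?_
  obtain ⟨c, hc, hcf⟩ := exists_norm_indicator_const_mul_le hY hb ρX hE hEfin
  have h1 := (hX.eq_zero_iff _ ((hf.mul_const _).indicator hE)).1
    (le_zero_iff.1 (h ▸ hcf f))
  rw [ae_restrict_iff' hE]
  filter_upwards [h1] with x hx hxE
  rw [indicator_of_mem hxE] at hx
  simpa [hc] using hx

end Multiplier

/-! ### The inequality for rearrangements -/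

/-- The powers of t cancel because the exponents j/k and 1 - j/k add up to one. -/
theorem rearrangement_weakGradient_le {n : ℕ} (hn : 1 ≤ n) {u : RSpace n → ℝ}
    (hu : LocallyIntegrable u) {j k : ℕ} (hk : 0 < k) (hjk : j ≤ k)
    {w : RSpace n → EuclideanSpace ℝ (Fin j → Fin n)} (hw : IsWeakGradient j u w)
    {v : RSpace n → EuclideanSpace ℝ (Fin k → Fin n)} (hv : IsWeakGradient k u v)
    {t : ℝ} (ht : 0 < t) (hfin : maximalRearrangement volume (fun x => ‖u x‖ₑ) t ≠ ∞) :
    rearrangement volume (fun x => ‖w x‖ₑ) t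
      ≤ (n ^ j * 3 ^ (k * j) : ℕ)
        * (maximalRearrangement volume (fun x => ‖v x‖ₑ) t ^ ((j : ℝ) / k)
          * maximalRearrangement volume (fun x => ‖u x‖ₑ) t ^ (1 - (j : ℝ) / k)) := by
  have hT0 : ENNReal.ofReal t ≠ 0 := by simpa
  have hTt : ENNReal.ofReal t ≠ ∞ := by simp
  have ha : (0 : ℝ) ≤ (j : ℝ) / k := by positivity
  have ha' : (0 : ℝ) ≤ 1 - (j : ℝ) / k := by
    rw [sub_nonneg]; exact div_le_one_of_le₀ (by exact_mod_cast hjk) (by positivity)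
  have hNu := maxSetLIntegral_le_maximalRearrangement hu.aestronglyMeasurable.enorm ht
  have hNv := maxSetLIntegral_le_maximalRearrangement hv.aemeasurable_enorm ht
  have hNw := rearrangement_le_maxSetLIntegral hn hw.aemeasurable_enorm ht
  have hN := maxSetLIntegral_weakGradient_le hu hk hjk hw hv
    (hNu.trans_lt (ENNReal.mul_lt_top hTt.lt_top hfin.lt_top)).ne
  rw [← ENNReal.mul_le_mul_iff_right hT0 hTt]
  refine hNw.trans (hN.trans ?_)
  calc _ ≤ ((n ^ j * 3 ^ (k * j) : ℕ) : ℝ≥0∞)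
        * ((ENNReal.ofReal t * maximalRearrangement volume (fun x => ‖v x‖ₑ) t) ^ ((j : ℝ) / k)
          * (ENNReal.ofReal t * maximalRearrangement volume (fun x => ‖u x‖ₑ) t)
            ^ (1 - (j : ℝ) / k)) := by gcongr
    _ = _ := by
      rw [ENNReal.mul_rpow_of_nonneg _ _ ha, ENNReal.mul_rpow_of_nonneg _ _ ha',
        mul_mul_mul_comm, ← ENNReal.rpow_add _ _ hT0 hTt, add_sub_cancel, ENNReal.rpow_one,
        mul_left_comm]

theorem maximalRearrangement_le_radialRearrangement {α : Type*} [MeasurableSpace α]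
    (μ : Measure α) (f : α → ℝ≥0∞) {n : ℕ} (x : RSpace n) {t : ℝ}
    (ht : (volume (Metric.ball (0 : RSpace n) ‖x‖)).toReal < t) :
    maximalRearrangement μ f t ≤ radialRearrangement n (maximalRearrangement μ f) x :=
  maximalRearrangement_le_rearrangement μ f ENNReal.toReal_nonneg ht

/-- An infinite value at t would make the radial function infinite on the ball of measure t. -/
theorem maximalRearrangement_ne_top_of_ae {α : Type*} [MeasurableSpace α] (μ : Measure α)
    (f : α → ℝ≥0∞) {n : ℕ} (hn : 1 ≤ n)
    (h : ∀ᵐ x, radialRearrangement n (maximalRearrangement μ f) x < ∞) {t : ℝ} (ht : 0 < t) :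
    maximalRearrangement μ f t ≠ ∞ := by
  intro htop
  have h1 : {x : RSpace n | volume (Metric.ball (0 : RSpace n) ‖x‖) < ENNReal.ofReal t} ⊆
      {x | ¬ radialRearrangement n (maximalRearrangement μ f) x < ∞} := by
    intro x hx
    have h2 := maximalRearrangement_le_radialRearrangement μ f x
      ((ENNReal.lt_ofReal_iff_toReal_lt measure_ball_lt_top.ne).1 hx)
    rw [htop] at h2
    exact not_lt.2 h2
  have h3 := measure_mono_null h1 (ae_iff.1 h)
  rw [volume_ball_norm_lt hn] at h3
  simp [ht.not_ge] at h3

theorem norm_weakGradient_le {n : ℕ} (hn : 1 ≤ n) {ρ : (RSpace n → ℝ≥0∞) → ℝ≥0∞}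
    (hρ : IsRIBanachFunctionNorm volume ρ) {u : RSpace n → ℝ}
    (hu : LocallyIntegrable u) {j k : ℕ} (hk : 0 < k) (hjk : j ≤ k)
    {w : RSpace n → EuclideanSpace ℝ (Fin j → Fin n)} (hw : IsWeakGradient j u w)
    {v : RSpace n → EuclideanSpace ℝ (Fin k → Fin n)} (hv : IsWeakGradient k u v)
    (hfin : ∀ᵐ x, radialRearrangement n
      (maximalRearrangement volume fun x => ‖u x‖ₑ) x < ∞) :
    ρ (fun x => ‖w x‖ₑ) ≤ (2 * (n ^ j * 3 ^ (k * j) : ℕ) : ℝ≥0) * ρ (fun x =>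
      radialRearrangement n (maximalRearrangement volume fun x => ‖u x‖ₑ) x ^ (1 - (j : ℝ) / k)
      * radialRearrangement n (maximalRearrangement volume fun x => ‖v x‖ₑ) x
        ^ ((j : ℝ) / k)) := by
  have : Nonempty (Fin n) := ⟨⟨0, hn⟩⟩
  have ha : (0 : ℝ) ≤ (j : ℝ) / k := by positivity
  have ha' : (0 : ℝ) ≤ 1 - (j : ℝ) / k := by
    rw [sub_nonneg]; exact div_le_one_of_le₀ (by exact_mod_cast hjk) (by positivity)
  have hmu := (measurable_radialRearrangement n
    (maximalRearrangement volume fun x => ‖u x‖ₑ)).pow_const (1 - (j : ℝ) / k)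
  have hmv := (measurable_radialRearrangement n
    (maximalRearrangement volume fun x => ‖v x‖ₑ)).pow_const ((j : ℝ) / k)
  have hm : AEMeasurable (fun x =>
      radialRearrangement n (maximalRearrangement volume fun x => ‖u x‖ₑ) x ^ (1 - (j : ℝ) / k)
      * radialRearrangement n (maximalRearrangement volume fun x => ‖v x‖ₑ) x
        ^ ((j : ℝ) / k)) volume := (hmu.mul hmv).aemeasurable
  rw [← hρ.smul _ _ hm,
    ← representation_rearrangement hn hρ hw.aemeasurable_enorm, representation]
  refine hρ.mono _ _ (measurable_radialRearrangement n _).aemeasurable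
    (hm.const_mul _) ?_
  -- The origin corresponds to t = 0, where the rearrangement inequality is not available.
  have hne : ∀ᵐ x : RSpace n, x ≠ 0 := by simp [ae_iff]
  filter_upwards [hne] with x hx
  have hpos : 0 < (volume (Metric.ball (0 : RSpace n) ‖x‖)).toReal :=
    ENNReal.toReal_pos (Metric.measure_ball_pos _ _ (norm_pos_iff.2 hx)).ne'
      measure_ball_lt_top.ne
  have hle : ∀ {β : Type} [NormedAddCommGroup β] (f : RSpace n → β),
      maximalRearrangement volume (fun x => ‖f x‖ₑ)
        (volume (Metric.ball (0 : RSpace n) ‖x‖)).toReal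
      ≤ 2 * radialRearrangement n (maximalRearrangement volume fun x => ‖f x‖ₑ) x := by
    intro β _ f
    refine (maximalRearrangement_le_two_mul _ _ hpos).trans ?_
    gcongr
    exact maximalRearrangement_le_radialRearrangement _ _ _ (by linarith)
  rw [radialRearrangement, rearrangement_rearrangement]
  refine (rearrangement_weakGradient_le hn hu hk hjk hw hv hpos
    (maximalRearrangement_ne_top_of_ae _ _ hn hfin hpos)).trans ?_
  calc _ ≤ ((n ^ j * 3 ^ (k * j) : ℕ) : ℝ≥0∞)
        * ((2 * radialRearrangement n (maximalRearrangement volume fun x => ‖v x‖ₑ) x)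
            ^ ((j : ℝ) / k)
          * (2 * radialRearrangement n (maximalRearrangement volume fun x => ‖u x‖ₑ) x)
            ^ (1 - (j : ℝ) / k)) := by
        gcongr
        · exact hle v
        · exact hle u
    _ = _ := by
      rw [ENNReal.mul_rpow_of_nonneg _ _ ha, ENNReal.mul_rpow_of_nonneg _ _ ha',
        mul_mul_mul_comm, ← ENNReal.rpow_add _ _ (by simp) (by simp), add_sub_cancel,
        ENNReal.rpow_one, ENNReal.coe_mul, ENNReal.coe_natCast, ENNReal.coe_ofNat,
        mul_comm (_ ^ ((j : ℝ) / k)), ← mul_assoc, mul_comm _ (2 : ℝ≥0∞)]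

end

open MeasureTheory ENNReal NNReal in
/-- Gagliardo--Nirenberg inequality for rearrangement-invariant Banach function spaces. -/
theorem theorem1p2 (n j k : ℕ) (hn : 1 ≤ n) (hj : 1 ≤ j) (hjk : j < k)
    (ρX ρY : (RSpace n → ℝ≥0∞) → ℝ≥0∞)
    (hX : IsRIBanachFunctionNorm volume ρX) (hY : IsRIBanachFunctionNorm volume ρY)
    (hYX : LocallyEmbedded volume (convexification ρY ((k : ℝ) / j)) ρX) :
    ∃ C : ℝ≥0, ∀ (u : RSpace n → ℝ)
      (Dj : RSpace n → EuclideanSpace ℝ (Fin j → Fin n))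
      (Dk : RSpace n → EuclideanSpace ℝ (Fin k → Fin n)),
      WeaklyDifferentiable k u → IsWeakGradient j u Dj → IsWeakGradient k u Dk →
      ∀ A B : ℝ≥0∞,
      A = representation ρY (maximalRearrangement volume fun x => ‖Dk x‖ₑ) →
      B = representation
        (convexification
          (multiplierNorm volume (convexification ρY ((k : ℝ) / j)) ρX) (1 - (j : ℝ) / k))
        (maximalRearrangement volume fun x => ‖u x‖ₑ) →
      -- the indeterminate product `0 * ∞` on the right-hand side is excluded
      ¬ (A = 0 ∧ B = ∞) →
      ρX (fun x => ‖Dj x‖ₑ) ≤ C * A ^ ((j : ℝ) / k) * B ^ (1 - (j : ℝ) / k) := by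
  have hj0 : (0 : ℝ) < j := by exact_mod_cast hj
  have hk : 0 < k := by omega
  have hk0 : (0 : ℝ) < k := by exact_mod_cast hk
  have hb : 0 < (k : ℝ) / j := by positivity
  have ha : 0 < (j : ℝ) / k := by positivity
  have ha' : 0 < 1 - (j : ℝ) / k := by
    rw [sub_pos, div_lt_one hk0]; exact_mod_cast hjk
  have hba : 1 / ((k : ℝ) / j) = (j : ℝ) / k := one_div_div _ _
  have hC : ((2 * (n ^ j * 3 ^ (k * j) : ℕ) : ℝ≥0) : ℝ≥0∞) ≠ 0 := by
    have : 0 < n ^ j * 3 ^ (k * j) := by positivity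
    simp only [ne_eq, ENNReal.coe_eq_zero]
    positivity
  refine ⟨2 * (n ^ j * 3 ^ (k * j) : ℕ), fun u Dj Dk hu hDj hDk A B hA hB hAB => ?_⟩
  set R₁ := radialRearrangement n (maximalRearrangement volume fun x => ‖Dk x‖ₑ)
  set R₂ := radialRearrangement n (maximalRearrangement volume fun x => ‖u x‖ₑ)
  have hR₁ : Measurable R₁ := measurable_radialRearrangement n _
  have hR₂ : Measurable R₂ := measurable_radialRearrangement n _
  -- The exponents k/j and j/k cancel inside the norm, which puts the right-hand side in the form
  -- required by Hölder's inequality.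
  have hA' : A ^ ((j : ℝ) / k)
      = convexification ρY ((k : ℝ) / j) (fun x => R₁ x ^ ((j : ℝ) / k)) := by
    rw [hA, representation, convexification, hba]
    simp only [← ENNReal.rpow_mul, div_mul_div_cancel₀ hk0.ne', div_self hj0.ne',
      ENNReal.rpow_one]
    rfl
  have hB' : B ^ (1 - (j : ℝ) / k) = multiplierNorm volume (convexification ρY ((k : ℝ) / j)) ρX
      (fun x => R₂ x ^ (1 - (j : ℝ) / k)) := by
    rw [hB, representation, convexification, ← ENNReal.rpow_mul, one_div_mul_cancel ha'.ne',
      ENNReal.rpow_one]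
  rcases eq_or_ne B ∞ with hBtop | hBtop
  · have hA0 : A ≠ 0 := fun h => hAB ⟨h, hBtop⟩
    rw [hBtop, ENNReal.top_rpow_of_pos ha', ENNReal.mul_top]
    · exact le_top
    · refine mul_ne_zero hC fun h => hA0 ?_
      exact (ENNReal.rpow_eq_zero_iff_of_pos ha).1 h
  have hm₂ : AEMeasurable (fun x => R₂ x ^ (1 - (j : ℝ) / k)) volume :=
    (hR₂.pow_const _).aemeasurable
  have hm₁ : AEMeasurable (fun x => R₁ x ^ ((j : ℝ) / k)) volume :=
    (hR₁.pow_const _).aemeasurable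
  have hBfin := ENNReal.rpow_ne_top_of_nonneg ha'.le hBtop
  -- Finiteness of B is what makes N_t(u) finite for every t, as Landau's argument requires.
  have hR₂fin : ∀ᵐ x, R₂ x < ∞ := by
    filter_upwards [ae_lt_top_of_multiplierNorm_ne_top hX.toIsBanachFunctionNorm
      hY.toIsBanachFunctionNorm hb hm₂ (hB' ▸ hBfin)] with x hx
    exact (ENNReal.rpow_lt_top_iff_of_pos ha').1 hx
  refine (norm_weakGradient_le hn hX hu.1 hk hjk.le hDj hDk hR₂fin).trans ?_
  rw [mul_assoc]
  gcongr
  rcases eq_or_ne A ∞ with hAtop | hAtop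
  · rcases eq_or_ne B 0 with hB0 | hB0
    · have h0 := ae_eq_zero_of_multiplierNorm_eq_zero hX.toIsBanachFunctionNorm
        hY.toIsBanachFunctionNorm hb hm₂ (by rw [← hB', hB0, ENNReal.zero_rpow_of_pos ha'])
      rw [hX.eq_zero_of_ae]
      · exact zero_le
      · filter_upwards [h0] with x hx
        rw [hx, zero_mul]
        rfl
    · rw [hAtop, ENNReal.top_rpow_of_pos ha, ENNReal.top_mul]
      · exact le_top
      · exact fun h => hB0 ((ENNReal.rpow_eq_zero_iff_of_pos ha').1 h)
  · rw [mul_comm, hA', hB']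
    exact norm_mul_le_multiplierNorm_mul hX.toIsBanachFunctionNorm hY.toIsBanachFunctionNorm hb
      hm₂ hm₁ (hA' ▸ ENNReal.rpow_ne_top_of_nonneg ha.le hAtop)
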